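/- Let $T$ be a complete $\omega$-categorical theory in a countable language, let $\kappa$ be an infinite cardinal and let $\mathcal M\models T$ be $\kappa$-saturated, with universe $M$. Let $M^{eq}$ consist of the elements of $M$ (the real elements) and of all equivalence classes (the imaginary elements) of $\emptyset$-definable equivalence relations on $M^k$, $1\le k<\omega$. For $n<\omega$ let $M_n\subseteq M^{eq}$ consist of the real elements and of the classes of $\emptyset$-definable equivalence relations on $M^k$ with $1\le k\le n$. All subsets of $M^{eq}$ below are assumed to have cardinality less than $\kappa$. We write $AB$ for $A\cup B$, $\mathrm{acl}^{eq}$ for algebraic closure in $\mathcal M^{eq}$, and $\mathrm{acl}^n(A)=\mathrm{acl}^{eq}(A)\cap M_n$. The $n$-rank is defined as follows: $\mathrm{rk}^n(A/B)\ge 0$ always; $\mathrm{rk}^n(A/B)\ge\alpha+1$ iff there is $a\in\mathrm{acl}^n(A)\setminus\mathrm{acl}^n(B)$ with $\mathrm{rk}^n(A/\{a\}\cup B)\ge\alpha$; for limit $\alpha$, $\mathrm{rk}^n(A/B)\ge\alpha$ iff $\mathrm{rk}^n(A/B)\ge\beta$ for all $\beta<\alpha$; and $\mathrm{rk}^n(A/B)=\alpha$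 iff $\mathrm{rk}^n(A/B)\ge\alpha$ and $\mathrm{rk}^n(A/B)\not\ge\alpha+1$ (if $\mathrm{rk}^n(A/B)\ge\alpha$ for all ordinals $\alpha$, the rank is undefined; it then counts as larger than every ordinal). We say that $A$ is $n$-independent from $B$ over $C$ if $\mathrm{rk}^n(A'/BC)=\mathrm{rk}^n(A'/C)$ for every finite $A'\subseteq A$. Fix $n<\omega$ and assume the exchange property with respect to $n$: whenever $C\subseteq M^{eq}$, $2\le k<\omega$, $a_1,\dots,a_k\in M_n$, $\mathrm{rk}^n(\{a_i\}/C)=1$ for $i=1,\dots,k$, and $$a_k\in\mathrm{acl}^{eq}(\{a_1,\dots,a_{k-1}\}\cup C)\setminus\mathrm{acl}^{eq}(\{a_2,\dots,a_{k-1}\}\cup C),$$ then $a_1\in\mathrm{acl}^{eq}(\{a_2,\dots,a_k\}\cup C)$. (1) Let $A,C\subseteq M^{eq}$ and $B\subseteq M_n$, where $A$ and $B$ are finite. If $\mathrm{rk}^n(A/BC)<\mathrm{rk}^n(A/C)$, then $\mathrm{rk}^n(B/AC)<\mathrm{rk}^n(B/C)$. (2) Let $A,C\subseteq M^{eq}$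 and $B\subseteq M_n$. If $A$ is not $n$-independent from $B$ over $C$, then $B$ is not $n$-independent from $A$ over $C$. -/

import Mathlib

open FirstOrder Cardinal

universe u v w

namespace NRank

/-- The structure `M` is `κ`-saturated: every set of formulas in finitely many variables, with
parameters from a set of fewer than `κ` elements, that is finitely satisfiable in `M` is realized
in `M`. -/
def IsSaturated (L : FirstOrder.Language.{u, v}) (M : Type w) [L.Structure M] (κ : Cardinal.{w}) : Prop :=
  ∀ A : Set M, #A < κ → ∀ (m : ℕ) (p : Set (L[[A]].Formula (Fin m))),
    (∀ p₀ ⊆ p, p₀.Finite → ∃ x : Fin m → M, ∀ φ ∈ p₀, φ.Realize x) →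
      ∃ x : Fin m → M, ∀ φ ∈ p, φ.Realize x

/-- Algebraic closure in a first-order structure: `a` is algebraic over `A` if it lies in a finite
set that is definable by a formula with parameters from `A`. -/
def acl (L : FirstOrder.Language.{u, v}) {N : Type w} [L.Structure N] (A : Set N) : Set N :=
  {a | ∃ S : Set N, A.Definable₁ L S ∧ S.Finite ∧ a ∈ S}

section Imaginaries

variable (L : FirstOrder.Language.{u, v}) (M : Type w) [L.Structure M]

/-- The `∅`-definable equivalence relations on `M ^ k`. -/
def DefEquiv (k : ℕ) : Type w :=
  {E : Setoid (Fin k → M) //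
    (∅ : Set M).Definable L {x : Fin k ⊕ Fin k → M | E (x ∘ Sum.inl) (x ∘ Sum.inr)}}

/-- The universe of `M^eq`: the elements of `M` (the real elements), together with all equivalence
classes (the imaginary elements) of `∅`-definable equivalence relations on `M ^ (k + 1)`, for all
`k`, where classes of distinct relations count as distinct elements. -/
inductive Meq : Type w
  | real (x : M) : Meq
  | imag (k : ℕ) (E : DefEquiv L M (k + 1)) (q : Quotient E.1) : Meq

/-- The relation symbols of the vocabulary of `M^eq`. As the operations of `M` are only partially
defined on `M^eq`, an `m`-ary function symbol is replaced by an `(m + 1)`-ary relation symbol for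
its graph. -/
inductive EqRelSymb : ℕ → Type (max u v w)
  | rel {m : ℕ} (R : L.Relations m) : EqRelSymb m
  | graph {m : ℕ} (f : L.Functions m) : EqRelSymb (m + 1)
  | home : EqRelSymb 1
  | sort {k : ℕ} (E : DefEquiv L M (k + 1)) : EqRelSymb 1
  | proj {k : ℕ} (E : DefEquiv L M (k + 1)) : EqRelSymb (k + 1 + 1)

/-- The vocabulary of `M^eq`. -/
def eqLang : FirstOrder.Language.{0, max u v w} where
  Functions := fun _ => Empty
  Relations := EqRelSymb L M

/-- The structure `M^eq`: the relations and graphs of functions of `M` hold for real elements only;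
`home` and `sort E` are the sets of real elements and of classes of `E`; and `proj E` is the graph
of the map that takes a real tuple to its class modulo `E`. -/
instance eqStructure : (eqLang L M).Structure (Meq L M) where
  funMap := fun f => Empty.elim f
  RelMap := fun r => match r with
    | .rel (m := m) R => fun x =>
        ∃ y : Fin m → M, (∀ i, x i = .real (y i)) ∧ FirstOrder.Language.Structure.RelMap R y
    | .graph (m := m) f => fun x =>
        ∃ y : Fin m → M, (∀ i, x (Fin.castSucc i) = .real (y i)) ∧
          x (Fin.last m) = .real (FirstOrder.Language.Structure.funMap f y)
    | .home => fun x => ∃ y : M, x 0 = .real y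
    | .sort (k := k) E => fun x => ∃ q : Quotient E.1, x 0 = .imag k E q
    | .proj (k := k) E => fun x =>
        ∃ y : Fin (k + 1) → M, (∀ i, x (Fin.castSucc i) = .real (y i)) ∧
          x (Fin.last (k + 1)) = .imag k E (Quotient.mk E.1 y)

/-- The set `M_n`: `M_0 = M`, and `M_{n+1}` adds to `M_n` all equivalence classes of
`∅`-definable equivalence relations on `M ^ (n + 1)`. -/
def level : ℕ → Set (Meq L M)
  | 0 => Set.range Meq.real
  | n + 1 => level n ∪
      {a | ∃ (E : DefEquiv L M (n + 1)) (q : Quotient E.1), a = Meq.imag n E q}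

end Imaginaries

section Rank

variable {L : FirstOrder.Language.{u, v}} {M : Type w} [L.Structure M]

/-- Algebraic closure computed in `M^eq`. -/
def aclEq (A : Set (Meq L M)) : Set (Meq L M) := acl (eqLang L M) A

/-- `acl^n(A)`, the part of the algebraic closure of `A` in `M^eq` that lies in `M_n`. -/
def aclN (n : ℕ) (A : Set (Meq L M)) : Set (Meq L M) := aclEq A ∩ level L M n

/-- `RankGE n A α B` says that `rk^n(A / B) ≥ α`. -/
noncomputable def RankGE (n : ℕ) (A : Set (Meq L M)) (α : Ordinal.{w}) : Set (Meq L M) → Prop :=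
  Ordinal.limitRecOn α
    (fun _ => True)
    (fun _ ge B => ∃ a ∈ aclN n A \ aclN n B, ge ({a} ∪ B))
    (fun β _ ge B => ∀ (γ : Ordinal.{w}) (h : γ < β), ge γ h B)

open Classical in
/-- The `n`-rank `rk^n(A / B)`: the ordinal `α` with `rk^n(A / B) ≥ α` and not
`rk^n(A / B) ≥ α + 1`, and `⊤` if there is none (the rank is undefined). -/
noncomputable def rk (n : ℕ) (A B : Set (Meq L M)) : WithTop Ordinal.{w} :=
  if h : ∃ α : Ordinal.{w}, RankGE n A α B ∧ ¬ RankGE n A (α + 1) B then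
    ((Classical.choose h : Ordinal.{w}) : WithTop Ordinal.{w})
  else ⊤

/-- `A` is `n`-independent from `B` over `C`. -/
def Indep (n : ℕ) (A B C : Set (Meq L M)) : Prop :=
  ∀ A' ⊆ A, A'.Finite → rk n A' (B ∪ C) = rk n A' C

variable (L M) in
/-- The exchange property with respect to `n`, over all parameter sets with fewer than `κ`
elements. The elements are `a 1, …, a k`. -/
def Exchange (κ : Cardinal.{w}) (n : ℕ) : Prop :=
  ∀ C : Set (Meq L M), #C < κ → ∀ k : ℕ, 2 ≤ k → ∀ a : ℕ → Meq L M,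
    (∀ i ∈ Set.Icc 1 k, a i ∈ level L M n) →
    (∀ i ∈ Set.Icc 1 k, rk n {a i} C = 1) →
    a k ∈ aclEq (a '' Set.Ico 1 k ∪ C) \ aclEq (a '' Set.Ico 2 k ∪ C) →
    a 1 ∈ aclEq (a '' Set.Icc 2 k ∪ C)

end Rank

end NRank

/-! For finite `A`, ω-categoricity makes `aclN n A` finite (`finite_aclN`), so its rank over a base
is the maximal length of a chain in `aclN n A` whose terms are each non-algebraic over the base and
the earlier terms.

Suppose passing from C to BC lowers the rank of A. In a maximal chain over C, let a be the first
term algebraic over BC', where C' is C with the earlier terms; without such a term the chain would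
survive over BC. Maximality gives a rank one over C', since otherwise a could be replaced by two
terms (`RankGE.add_two`). Exchange then turns any chain for B over aC' into a longer one over C'
(`RankGE.add_one_of_mem_aclEq`). As aC' lies in acl(AC), monotonicity yields rk(B/AC) ≤ rk(B/aC') <
rk(B/C') ≤ rk(B/C).

For the finiteness, omitting types and categoricity leave only finitely many ∅-definable sets of
m-tuples (`finite_definable_fin`). A back-and-forth argument (`SameType.realize_iff`) carries this
to M^eq: algebraic elements of one sort that are coded by tuples of the same type lie in a common
finite set. -/

namespace NRank

/-! ### Algebraic closure is a finitary closure operator -/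

section AlgebraicClosure

open FirstOrder.Language Set

variable {L : FirstOrder.Language.{u, v}} {N : Type w} [L.Structure N]

theorem acl_mono {A B : Set N} (h : A ⊆ B) : acl L A ⊆ acl L B := by
  rintro a ⟨S, hS, hf, ha⟩
  exact ⟨S, Set.Definable.mono hS h, hf, ha⟩

theorem subset_acl (A : Set N) : A ⊆ acl L A := fun a ha =>
  ⟨{a}, Set.Definable.singleton_of_mem L ha, Set.finite_singleton a, rfl⟩

theorem exists_finite_of_mem_acl {A : Set N} {a : N} (h : a ∈ acl L A) :
    ∃ A₀ ⊆ A, A₀.Finite ∧ a ∈ acl L A₀ := by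
  obtain ⟨S, hS, hf, ha⟩ := h
  obtain ⟨A₀, hA₀, hd⟩ := Set.definable_iff_finitely_definable.1 hS
  exact ⟨A₀, hA₀, A₀.finite_toSet, S, hd, hf, ha⟩

/-- A set definable over `insert b X` is a fibre over `b` of a set definable over `X`. -/
theorem exists_definable_fibre {X S : Set N} {b : N} (h : (insert b X).Definable₁ L S) :
    ∃ D : Set (Fin 2 → N), X.Definable L D ∧ ∀ x, x ∈ S ↔ ![x, b] ∈ D := by
  classical
  obtain ⟨φ, hφ⟩ := Set.definable_iff_exists_formula_sum.1 h
  let g : ↥(insert b X) ⊕ Fin 1 → ↥X ⊕ Fin 2 :=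
    -- Only a parameter outside `X`, necessarily `b`, becomes the variable 1; if `b ∈ X` it stays a
    -- parameter.
    Sum.elim (fun p => if hp : p.1 ∈ X then .inl ⟨p.1, hp⟩ else .inr 1) (fun _ => .inr 0)
  refine ⟨_, Set.definable_iff_exists_formula_sum.2 ⟨φ.relabel g, rfl⟩, fun x => ?_⟩
  have h1 : x ∈ S ↔ (fun _ : Fin 1 => x) ∈ {x : Fin 1 → N | x 0 ∈ S} := Iff.rfl
  rw [h1, hφ, Set.mem_ofPred_eq, Set.mem_ofPred_eq, Formula.realize_relabel]
  have h2 : (Sum.elim (fun p : ↥X => (p : N)) ![x, b]) ∘ g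
      = Sum.elim (fun p : ↥(insert b X) => (p : N)) (fun _ : Fin 1 => x) := by
    funext p
    rcases p with p | p
    · by_cases hp : p.1 ∈ X
      · simp [g, hp]
      · have : p.1 = b := p.2.resolve_right hp
        simp [g, this, show b ∉ X from this ▸ hp]
    · simp [g]
  rw [h2]

/-- The parameters over which a definable family has at most `m` elements form a definable set. -/
theorem definable_setOf_fibre_card_le {X : Set N} {D : Set (Fin 2 → N)} (hD : X.Definable L D)
    (m : ℕ) :
    X.Definable L {v : Fin 1 → N | ∀ u : Fin (m + 1) → N,
      (∀ i, ![u i, v 0] ∈ D) → ¬ Function.Injective u} := by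
  have h1 : X.Definable L {z : Fin 1 ⊕ Fin (m + 1) → N |
      (∀ i, ![z (.inr i), z (.inl 0)] ∈ D)} := by
    have := Set.definable_iInter_of_finite (fun i : Fin (m + 1) =>
      hD.preimage_comp (β := Fin 1 ⊕ Fin (m + 1)) ![.inr i, .inl 0])
    convert this using 1
    ext z
    simp only [mem_ofPred_eq, mem_iInter, mem_preimage]
    refine forall_congr' fun i => ?_
    have : z ∘ ![Sum.inr i, Sum.inl 0] = ![z (.inr i), z (.inl 0)] := by
      funext j; fin_cases j <;> rfl
    rw [this]
  have h2 : X.Definable L {z : Fin 1 ⊕ Fin (m + 1) → N | ¬ Function.Injective (z ∘ Sum.inr)} := by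
    have := Set.definable_iUnion_of_finite
      (fun p : {p : Fin (m + 1) × Fin (m + 1) // p.1 ≠ p.2} =>
      (show X.Definable L {z : Fin 1 ⊕ Fin (m + 1) → N | z (.inr p.1.1) = z (.inr p.1.2)} from
        ⟨(Term.var (Sum.inr p.1.1)).equal (Term.var (Sum.inr p.1.2)), by ext z; simp⟩))
    convert this using 1
    ext z
    simp [Function.Injective]
    grind
  have h3 := (h1.compl.union h2).forall_of_finite
  convert h3 using 1
  ext v
  simp only [mem_ofPred_eq, mem_union, mem_compl_iff]
  refine forall_congr' fun u => ?_
  have : (Sum.elim v u) ∘ Sum.inr = u := by funext i; rfl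
  rw [this]
  simp only [Sum.elim_inr, Sum.elim_inl]
  tauto

/-- A finite set definable over `b` and `X` is a fibre of an `X`-definable family. Among the
finitely many conjugates of `b`, keep those whose fibres are no larger than this one: the union of
these fibres is finite and `X`-definable. -/
theorem acl_insert_subset {X : Set N} {b : N} (hb : b ∈ acl L X) :
    acl L (insert b X) ⊆ acl L X := by
  rintro a ⟨S, hS, hSf, ha⟩
  obtain ⟨S', hS', hSf', hb'⟩ := hb
  obtain ⟨D, hD, hDS⟩ := exists_definable_fibre hS
  let m := hSf.toFinset.card
  let F := {v : Fin 1 → N | ∀ u : Fin (m + 1) → N, (∀ i, ![u i, v 0] ∈ D) → ¬ Function.Injective u}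
  have hF : X.Definable L F := definable_setOf_fibre_card_le hD m
  refine ⟨{x | ∃ y ∈ S', ![x, y] ∈ D ∧ (fun _ => y) ∈ F}, ?_, ?_, b, hb', (hDS a).1 ha, ?_⟩
  · have h := ((Set.Definable.preimage_comp (fun _ : Fin 1 => (Sum.inr 0 : Fin 1 ⊕ Fin 1)) hS').inter
      ((hD.preimage_comp (β := Fin 1 ⊕ Fin 1) ![.inl 0, .inr 0]).inter
        (hF.preimage_comp (fun _ : Fin 1 => (Sum.inr 0 : Fin 1 ⊕ Fin 1))))).exists_of_finite
    unfold Set.Definable₁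
    convert h using 1
    ext v
    simp only [mem_ofPred_eq, mem_inter_iff, mem_preimage]
    have e1 : ∀ u : Fin 1 → N, (Sum.elim v u) ∘ ![Sum.inl 0, Sum.inr 0] = ![v 0, u 0] := by
      intro u; funext j; fin_cases j <;> rfl
    constructor
    · rintro ⟨y, h1, h2, h3⟩
      exact ⟨fun _ => y, h1, by rw [e1]; exact h2, h3⟩
    · rintro ⟨u, h1, h2, h3⟩
      rw [e1] at h2
      exact ⟨u 0, h1, h2, h3⟩
  · have : {x | ∃ y ∈ S', ![x, y] ∈ D ∧ (fun _ => y) ∈ F} ⊆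
        ⋃ y ∈ S' ∩ {y | (fun _ => y) ∈ F}, {x | ![x, y] ∈ D} := by
      rintro x ⟨y, h1, h2, h3⟩
      exact mem_biUnion (show y ∈ _ from ⟨h1, h3⟩) h2
    refine ((hSf'.subset inter_subset_left).biUnion ?_).subset this
    rintro y ⟨-, hy⟩
    by_contra hinf
    let e := Set.Infinite.natEmbedding _ hinf
    exact hy (fun i => (e i : N)) (fun i => (e i).2)
      (fun i j hij => Fin.ext (e.injective (Subtype.ext hij)))
  · intro u hu hinj
    have hu' : ∀ i, u i ∈ hSf.toFinset := fun i => hSf.mem_toFinset.2 ((hDS _).2 (hu i))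
    have := Finset.card_le_card_of_injOn (s := Finset.univ) u (fun i _ => hu' i) hinj.injOn
    simp [m] at this

theorem acl_subset_acl {X Y : Set N} (h : Y ⊆ acl L X) : acl L Y ⊆ acl L X := by
  intro a ha
  obtain ⟨Y₀, hY₀, hf, ha₀⟩ := exists_finite_of_mem_acl ha
  have key : acl L (Y₀ ∪ X) ⊆ acl L X := by
    clear ha₀
    induction Y₀, hf using Set.Finite.induction_on with
    | empty => simp
    | @insert b Y₁ _ _ ih =>
      rw [insert_union]
      have hb : b ∈ acl L (Y₁ ∪ X) :=
        acl_mono subset_union_right (h (hY₀ (mem_insert _ _)))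
      exact (acl_insert_subset hb).trans (ih ((subset_insert _ _).trans hY₀))
  exact key (acl_mono subset_union_left ha₀)

end AlgebraicClosure

/-! ### Calculus of the rank and symmetry of independence -/

section Rank

open Set

variable {L : FirstOrder.Language.{u, v}} {M : Type w} [L.Structure M] {n : ℕ}

theorem aclEq_mono {A B : Set (Meq L M)} (h : A ⊆ B) : aclEq A ⊆ aclEq B := acl_mono h

theorem subset_aclEq (A : Set (Meq L M)) : A ⊆ aclEq A := subset_acl A

theorem aclEq_subset_aclEq {A B : Set (Meq L M)} (h : A ⊆ aclEq B) : aclEq A ⊆ aclEq B :=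
  acl_subset_acl h

theorem exists_finite_of_mem_aclEq_union {B C : Set (Meq L M)} {a : Meq L M}
    (h : a ∈ aclEq (B ∪ C)) : ∃ B₀ ⊆ B, B₀.Finite ∧ a ∈ aclEq (B₀ ∪ C) := by
  obtain ⟨D, hD, hf, ha⟩ := exists_finite_of_mem_acl h
  refine ⟨D ∩ B, inter_subset_right, hf.subset inter_subset_left, aclEq_mono ?_ ha⟩
  intro d hd
  exact (hD hd).imp (fun h => ⟨hd, h⟩) id

@[simp]
theorem rankGE_zero (A B : Set (Meq L M)) : RankGE n A 0 B := by
  unfold RankGE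
  rw [Ordinal.limitRecOn_zero]
  trivial

theorem rankGE_add_one (A B : Set (Meq L M)) (α : Ordinal.{w}) :
    RankGE n A (α + 1) B ↔ ∃ a ∈ aclN n A \ aclN n B, RankGE n A α ({a} ∪ B) := by
  unfold RankGE
  rw [Ordinal.limitRecOn_add_one]

theorem rankGE_limit (A B : Set (Meq L M)) {α : Ordinal.{w}} (h : Order.IsSuccLimit α) :
    RankGE n A α B ↔ ∀ γ < α, RankGE n A γ B := by
  unfold RankGE
  rw [Ordinal.limitRecOn_limit (h := h)]

/-- A chain over a base remains a chain over any set algebraic over that base. All later changes of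
base go through this. -/
theorem RankGE.of_aclEq_subset {A : Set (Meq L M)} {α : Ordinal.{w}} {B B' : Set (Meq L M)}
    (h : RankGE n A α B') (hB : B ⊆ aclEq B') : RankGE n A α B := by
  induction α using Ordinal.limitRecOn generalizing B B' with
  | zero => simp
  | add_one α ih =>
    rw [rankGE_add_one] at h ⊢
    obtain ⟨a, ⟨ha, ha'⟩, h⟩ := h
    refine ⟨a, ⟨ha, fun h' => ha' ⟨aclEq_subset_aclEq hB h'.1, h'.2⟩⟩, ih h ?_⟩
    exact union_subset ((subset_aclEq _).trans (aclEq_mono subset_union_left))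
      (hB.trans (aclEq_mono subset_union_right))
  | limit α hα ih =>
    rw [rankGE_limit _ _ hα] at h ⊢
    exact fun γ hγ => ih γ hγ (h γ hγ) hB

theorem RankGE.anti {A B B' : Set (Meq L M)} {α : Ordinal.{w}}
    (h : RankGE n A α B') (hB : B ⊆ B') : RankGE n A α B :=
  h.of_aclEq_subset (hB.trans (subset_aclEq _))

theorem RankGE.of_add_one {A B : Set (Meq L M)} {α : Ordinal.{w}} (h : RankGE n A (α + 1) B) :
    RankGE n A α B := by
  obtain ⟨a, -, h⟩ := (rankGE_add_one _ _ _).1 h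
  exact h.anti subset_union_right

theorem RankGE.of_le {A B : Set (Meq L M)} {α β : Ordinal.{w}} (h : RankGE n A α B)
    (hβ : β ≤ α) : RankGE n A β B := by
  induction α using Ordinal.limitRecOn with
  | zero => rwa [nonpos_iff_eq_zero.1 hβ]
  | add_one α ih =>
    rcases hβ.eq_or_lt with rfl | hlt
    · exact h
    · exact ih h.of_add_one (Order.lt_add_one_iff.1 hlt)
  | limit α hα ih =>
    rcases hβ.eq_or_lt with rfl | hlt
    · exact h
    · exact (rankGE_limit _ _ hα).1 h β hlt

theorem rk_eq_of_rankGE {A B : Set (Meq L M)} {α : Ordinal.{w}} (h : RankGE n A α B)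
    (h' : ¬ RankGE n A (α + 1) B) : rk n A B = α := by
  have hex : ∃ α : Ordinal.{w}, RankGE n A α B ∧ ¬ RankGE n A (α + 1) B := ⟨α, h, h'⟩
  unfold rk
  rw [dif_pos hex]
  obtain ⟨h1, h2⟩ := Classical.choose_spec hex
  congr 1
  refine le_antisymm ?_ ?_
  · by_contra hlt
    exact h' (h1.of_le (Order.add_one_le_of_lt (not_le.1 hlt)))
  · by_contra hlt
    exact h2 (h.of_le (Order.add_one_le_of_lt (not_le.1 hlt)))

theorem rk_eq_coe_iff {A B : Set (Meq L M)} {α : Ordinal.{w}} :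
    rk n A B = α ↔ RankGE n A α B ∧ ¬ RankGE n A (α + 1) B := by
  refine ⟨fun h => ?_, fun h => rk_eq_of_rankGE h.1 h.2⟩
  unfold rk at h
  split_ifs at h with hex
  · rw [← WithTop.coe_injective h]
    exact Classical.choose_spec hex
  · exact absurd h WithTop.top_ne_coe

/-- Each term of a chain becomes algebraic once added to the base, so the finite set `aclN n A \
aclN n B` strictly shrinks at every step. -/
theorem not_rankGE_of_ncard_le {A : Set (Meq L M)} (hA : (aclN n A).Finite) (N : ℕ)
    {B : Set (Meq L M)} (h : (aclN n A \ aclN n B).ncard ≤ N) :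
    ¬ RankGE n A ((N : Ordinal.{w}) + 1) B := by
  induction N generalizing B with
  | zero =>
    rw [rankGE_add_one]
    rintro ⟨a, ha, -⟩
    rw [Nat.le_zero, ncard_eq_zero (hA.subset sdiff_subset)] at h
    simp [h] at ha
  | succ N ih =>
    rw [rankGE_add_one]
    rintro ⟨a, ha, h'⟩
    push_cast at h'
    refine ih ?_ h'
    have hlt : (aclN n A \ aclN n ({a} ∪ B)).ncard < (aclN n A \ aclN n B).ncard := by
      refine ncard_lt_ncard ?_ (hA.subset sdiff_subset)
      refine ⟨sdiff_subset_sdiff_right (inter_subset_inter_left _ (aclEq_mono subset_union_right)),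
        fun hsub => ?_⟩
      exact (hsub ha).2 ⟨subset_aclEq _ (Or.inl rfl), ha.1.2⟩
    omega

theorem exists_rk_eq_natCast {A : Set (Meq L M)} (hA : (aclN n A).Finite) (B : Set (Meq L M)) :
    ∃ r : ℕ, rk n A B = ((r : Ordinal.{w}) : WithTop Ordinal.{w}) ∧
      RankGE n A (r : Ordinal.{w}) B ∧ ¬ RankGE n A ((r : Ordinal.{w}) + 1) B := by
  classical
  have hex : ∃ N : ℕ, ¬ RankGE n A ((N : Ordinal.{w}) + 1) B :=
    ⟨_, not_rankGE_of_ncard_le hA _ le_rfl⟩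
  have h1 := Nat.find_spec hex
  have h2 : RankGE n A ((Nat.find hex : ℕ) : Ordinal.{w}) B := by
    rcases hN : Nat.find hex with _ | k
    · simp
    · have := Nat.find_min hex (m := k) (by omega)
      push_cast
      exact not_not.1 this
  exact ⟨_, rk_eq_of_rankGE h2 h1, h2, h1⟩

/-- Among finite ranks, inequalities between ranks are implications between lower bounds. -/
theorem rk_le_rk {A A' B B' : Set (Meq L M)} (hA : (aclN n A).Finite) (hA' : (aclN n A').Finite)
    (h : ∀ r : ℕ, RankGE n A (r : Ordinal.{w}) B → RankGE n A' (r : Ordinal.{w}) B') :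
    rk n A B ≤ rk n A' B' := by
  obtain ⟨r, hr, h1, -⟩ := exists_rk_eq_natCast hA B
  obtain ⟨s, hs, -, h2⟩ := exists_rk_eq_natCast hA' B'
  rw [hr, hs, WithTop.coe_le_coe]
  by_contra hlt
  exact h2 ((h r h1).of_le (Order.add_one_le_of_lt (not_le.1 hlt)))

theorem rk_lt_rk {A A' B B' : Set (Meq L M)} (hA : (aclN n A).Finite) (hA' : (aclN n A').Finite)
    (h : ∀ r : ℕ, RankGE n A (r : Ordinal.{w}) B → RankGE n A' ((r : Ordinal.{w}) + 1) B') :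
    rk n A B < rk n A' B' := by
  obtain ⟨r, hr, h1, -⟩ := exists_rk_eq_natCast hA B
  obtain ⟨s, hs, -, h2⟩ := exists_rk_eq_natCast hA' B'
  rw [hr, hs, WithTop.coe_lt_coe]
  by_contra hle
  exact h2 ((h r h1).of_le (add_le_add_left (not_lt.1 hle) 1))

theorem rk_le_rk_of_subset_aclEq {A B B' : Set (Meq L M)} (hA : (aclN n A).Finite)
    (h : B ⊆ aclEq B') : rk n A B' ≤ rk n A B :=
  rk_le_rk hA hA fun _ hr => hr.of_aclEq_subset h

theorem rk_singleton_eq_one_iff {a : Meq L M} {C : Set (Meq L M)} :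
    rk n {a} C = 1 ↔ RankGE n {a} 1 C ∧ ¬ RankGE n {a} (1 + 1) C :=
  rk_eq_coe_iff (α := 1)

theorem rankGE_one_of_mem {A B : Set (Meq L M)} {a : Meq L M} (ha : a ∈ aclN n A)
    (h : a ∉ aclEq B) : RankGE n A 1 B := by
  rw [← zero_add 1, rankGE_add_one]
  exact ⟨a, ⟨ha, fun h' => h h'.1⟩, by simp⟩

theorem mem_aclN_singleton {a : Meq L M} (ha : a ∈ level L M n) : a ∈ aclN n {a} :=
  ⟨subset_aclEq _ rfl, ha⟩

theorem aclN_singleton_subset {A : Set (Meq L M)} {a : Meq L M} (ha : a ∈ aclN n A) :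
    aclN n {a} ⊆ aclN n A :=
  inter_subset_inter_left _ (aclEq_subset_aclEq (by simpa using ha.1))

/-- If `rk^n(a / C) ≥ 2` for some `a` in `acl^n(A)`, then two steps of a chain in `acl^n(A)` over
`C` can be made within `acl^n(a)`. -/
theorem RankGE.add_two {A C : Set (Meq L M)} {a : Meq L M} {α : Ordinal.{w}}
    (ha : a ∈ aclN n A) (h2 : RankGE n {a} (1 + 1) C) (h : RankGE n A α ({a} ∪ C)) :
    RankGE n A (α + 1 + 1) C := by
  obtain ⟨b, hb, h1⟩ := (rankGE_add_one _ _ _).1 h2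
  rw [← zero_add 1] at h1
  obtain ⟨c, hc, -⟩ := (rankGE_add_one _ _ _).1 h1
  refine (rankGE_add_one _ _ _).2 ⟨b, ⟨aclN_singleton_subset ha hb.1, hb.2⟩, ?_⟩
  refine (rankGE_add_one _ _ _).2 ⟨c, ⟨aclN_singleton_subset ha hc.1, hc.2⟩, ?_⟩
  refine h.of_aclEq_subset ?_
  have hle : aclEq {a} ⊆ aclEq ({a} ∪ C) := aclEq_mono subset_union_left
  rintro x (rfl | rfl | hx)
  · exact hle hc.1.1
  · exact hle hb.1.1
  · exact subset_aclEq _ (Or.inr hx)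

theorem Exchange.mem_aclEq {κ : Cardinal.{w}} (hex : Exchange L M κ n) {C : Set (Meq L M)}
    (hC : #C < κ) {a b : Meq L M} (ha : a ∈ level L M n) (hb : b ∈ level L M n)
    (ha1 : rk n {a} C = 1) (hb1 : rk n {b} C = 1) (h : a ∈ aclEq ({b} ∪ C)) (h' : a ∉ aclEq C) :
    b ∈ aclEq ({a} ∪ C) := by
  -- The case k = 2 of exchange, with first element `b` and second element `a`.
  let f : ℕ → Meq L M := fun i => if i = 1 then b else a
  have hI : ∀ i ∈ Icc 1 2, i = 1 ∨ i = 2 := by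
    rintro i ⟨h1, h2⟩
    omega
  have key := hex C hC 2 le_rfl f (fun i _ => by dsimp only [f]; split_ifs <;> assumption)
    (fun i _ => by dsimp only [f]; split_ifs <;> assumption)
  have e1 : Ico 1 2 = ({1} : Set ℕ) := by ext; simp; omega
  have e2 : Ico 2 2 = (∅ : Set ℕ) := by simp
  have e3 : Icc 2 2 = ({2} : Set ℕ) := by simp
  rw [e1, e2, e3] at key
  simpa [f] using key (by simpa [f] using ⟨h, h'⟩)

theorem mk_singleton_union_lt {κ : Cardinal.{w}} (hκ : ℵ₀ ≤ κ) {C : Set (Meq L M)} (hC : #C < κ)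
    (a : Meq L M) : #({a} ∪ C : Set (Meq L M)) < κ :=
  (mk_union_le _ _).trans_lt (add_lt_of_lt hκ (by simpa using one_lt_aleph0.trans_le hκ) hC)

/-- If `a` of rank one over `C` is algebraic over `B ∪ C`, then adding `a` to `C` lowers the rank
of `B`. -/
theorem RankGE.add_one_of_mem_aclEq {κ : Cardinal.{w}} (hκ : ℵ₀ ≤ κ) (hex : Exchange L M κ n)
    {B : Set (Meq L M)} (hB : B ⊆ level L M n) {a : Meq L M} (ha : a ∈ level L M n) (s : ℕ)
    {C : Set (Meq L M)} (hC : #C < κ) (haC : a ∉ aclEq C) (haB : a ∈ aclEq (B ∪ C))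
    (ha2 : ¬ RankGE n {a} (1 + 1) C) (h : RankGE n B (s : Ordinal.{w}) ({a} ∪ C)) :
    RankGE n B ((s : Ordinal.{w}) + 1) C := by
  induction s generalizing C with
  | zero =>
    -- If all of `B` were algebraic over `C`, so would be `a`.
    obtain ⟨b, hb, hbC⟩ : ∃ b ∈ B, b ∉ aclEq C := by
      by_contra! hcon
      exact haC (aclEq_subset_aclEq (union_subset hcon (subset_aclEq _)) haB)
    simpa using rankGE_one_of_mem ⟨subset_aclEq _ hb, hB hb⟩ hbC
  | succ s ih =>
    push_cast at h ⊢
    obtain ⟨b, ⟨hb, hb'⟩, h⟩ := (rankGE_add_one _ _ _).1 h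
    have hbaC : b ∉ aclEq ({a} ∪ C) := fun h' => hb' ⟨h', hb.2⟩
    have hbC : b ∉ aclEq C := fun h' => hbaC (aclEq_mono subset_union_right h')
    by_cases hab : a ∈ aclEq ({b} ∪ C)
    -- Here `b` makes `a` algebraic. If `b` has rank at least two over `C`, it supplies the extra
    -- term by itself; rank one is impossible, since exchange would make `b` algebraic over `a` and
    -- `C`.
    · by_cases hb2 : RankGE n {b} (1 + 1) C
      · refine RankGE.add_two hb hb2 (h.anti ?_)
        exact union_subset_union_right _ subset_union_right
      · exact absurd (hex.mem_aclEq hC ha hb.2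
          (rk_singleton_eq_one_iff.2 ⟨rankGE_one_of_mem (mem_aclN_singleton ha) haC, ha2⟩)
          (rk_singleton_eq_one_iff.2 ⟨rankGE_one_of_mem (mem_aclN_singleton hb.2) hbC, hb2⟩)
          hab haC) hbaC
    -- Otherwise `b` can be kept as first term, and the situation of `a` is unchanged over the
    -- larger base.
    · refine (rankGE_add_one _ _ _).2 ⟨b, ⟨hb, fun h' => hbC h'.1⟩, ?_⟩
      refine ih (mk_singleton_union_lt hκ hC b) hab
        (aclEq_mono (union_subset_union_right _ subset_union_right) haB)
        (fun h' => ha2 (h'.anti subset_union_right)) ?_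
      rwa [union_left_comm]

/-- If adding `B` to `C` lowers the rank of `A`, this is witnessed by an element of rank one over an
extension of `C` within the algebraic closure of `A ∪ C`. -/
theorem exists_rank_one_mem_aclEq {κ : Cardinal.{w}} (hκ : ℵ₀ ≤ κ) {A B : Set (Meq L M)} (r : ℕ)
    {C : Set (Meq L M)} (hC : #C < κ) (h : RankGE n A (r : Ordinal.{w}) C)
    (h' : ¬ RankGE n A ((r : Ordinal.{w}) + 1) C) (hB : ¬ RankGE n A (r : Ordinal.{w}) (B ∪ C)) :
    ∃ C' : Set (Meq L M), C ⊆ C' ∧ C' ⊆ aclEq (A ∪ C) ∧ #C' < κ ∧ ∃ a ∈ aclN n A,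
      a ∉ aclEq C' ∧ a ∈ aclEq (B ∪ C') ∧ ¬ RankGE n {a} (1 + 1) C' := by
  induction r generalizing C with
  | zero => simp at hB
  | succ r ih =>
    push_cast at h h' hB
    obtain ⟨a, ⟨ha, haC⟩, h⟩ := (rankGE_add_one _ _ _).1 h
    have haC' : a ∉ aclEq C := fun hh => haC ⟨hh, ha.2⟩
    -- Splitting `a` into two terms would give a chain longer than the rank allows.
    have ha2 : ¬ RankGE n {a} (1 + 1) C := fun hh => h' (RankGE.add_two ha hh h)
    by_cases haB : a ∈ aclEq (B ∪ C)
    · exact ⟨C, subset_rfl, subset_union_right.trans (subset_aclEq _), hC, a, ha, haC', haB, ha2⟩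
    -- If `a` is not algebraic over `B` and `C`, it is a legitimate first term over both bases, so
    -- the drop in rank persists after adding it.
    · obtain ⟨C', h1, h2, h3⟩ := ih (mk_singleton_union_lt hκ hC a) h
        (fun hh => h' ((rankGE_add_one _ _ _).2 ⟨a, ⟨ha, haC⟩, hh⟩))
        (fun hh => hB ((rankGE_add_one _ _ _).2 ⟨a, ⟨ha, fun h0 => haB h0.1⟩, by
          rwa [union_left_comm]⟩))
      refine ⟨C', subset_union_right.trans h1, h2.trans (aclEq_subset_aclEq ?_), h3⟩
      rintro x (hx | rfl | hx)
      · exact subset_aclEq _ (Or.inl hx)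
      · exact aclEq_mono subset_union_left ha.1
      · exact subset_aclEq _ (Or.inr hx)

/-- Only a finite part of `B` is needed to make the rank-one witness algebraic, and every larger
finite part works as well. This serves finite `B` directly and, for arbitrary `B`, exhibits a finite
subset that refutes independence. -/
theorem exists_finite_rk_lt {κ : Cardinal.{w}} (hκ : ℵ₀ ≤ κ) (hex : Exchange L M κ n)
    (hfin : ∀ A : Set (Meq L M), A.Finite → (aclN n A).Finite) {A B C : Set (Meq L M)}
    (hA : A.Finite) (hC : #C < κ) (hB : B ⊆ level L M n) (h : rk n A (B ∪ C) < rk n A C) :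
    ∃ B₀ ⊆ B, B₀.Finite ∧ ∀ B₁ ⊆ B, B₁.Finite → B₀ ⊆ B₁ → rk n B₁ (A ∪ C) < rk n B₁ C := by
  obtain ⟨r, hr, h1, h2⟩ := exists_rk_eq_natCast (hfin A hA) C
  have h3 : ¬ RankGE n A (r : Ordinal.{w}) (B ∪ C) := by
    intro h3
    obtain ⟨s, hs, -, h4⟩ := exists_rk_eq_natCast (hfin A hA) (B ∪ C)
    rw [hr, hs, WithTop.coe_lt_coe] at h
    exact h4 (h3.of_le (Order.add_one_le_of_lt h))
  obtain ⟨C', hCC', hC', hcard, a, ha, haC, haB, ha2⟩ := exists_rank_one_mem_aclEq hκ r hC h1 h2 h3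
  obtain ⟨B₀, hB₀, hf, haB₀⟩ := exists_finite_of_mem_aclEq_union haB
  refine ⟨B₀, hB₀, hf, fun B₁ hB₁ hf₁ hB₀₁ => ?_⟩
  have hlt : rk n B₁ ({a} ∪ C') < rk n B₁ C' := rk_lt_rk (hfin _ hf₁) (hfin _ hf₁) fun s hs =>
    RankGE.add_one_of_mem_aclEq hκ hex (hB₁.trans hB) ha.2 s hcard haC
      (aclEq_mono (union_subset_union_left _ hB₀₁) haB₀) ha2 hs
  refine (rk_le_rk_of_subset_aclEq (hfin _ hf₁) ?_).trans_lt (hlt.trans_le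
    (rk_le_rk_of_subset_aclEq (hfin _ hf₁) (hCC'.trans (subset_aclEq _))))
  exact union_subset (singleton_subset_iff.2 (aclEq_mono subset_union_left ha.1)) hC'

theorem rk_symmetry {κ : Cardinal.{w}} (hκ : ℵ₀ ≤ κ) (hex : Exchange L M κ n)
    (hfin : ∀ A : Set (Meq L M), A.Finite → (aclN n A).Finite) :
    (∀ A B C : Set (Meq L M), A.Finite → B.Finite → #C < κ → B ⊆ level L M n →
      rk n A (B ∪ C) < rk n A C → rk n B (A ∪ C) < rk n B C) ∧
    (∀ A B C : Set (Meq L M), #C < κ → B ⊆ level L M n → ¬ Indep n A B C → ¬ Indep n B A C) := by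
  refine ⟨fun A B C hA hB hC hBn h => ?_, fun A B C hC hBn h hind => h fun A' hA' hf => ?_⟩
  · obtain ⟨B₀, hB₀, -, h0⟩ := exists_finite_rk_lt hκ hex hfin hA hC hBn h
    exact h0 B subset_rfl hB hB₀
  · by_contra hne
    have hlt : rk n A' (B ∪ C) < rk n A' C := lt_of_le_of_ne
      (rk_le_rk_of_subset_aclEq (hfin _ hf) (subset_union_right.trans (subset_aclEq _))) hne
    obtain ⟨B₀, hB₀, hf₀, h0⟩ := exists_finite_rk_lt hκ hex hfin hf hC hBn hlt
    have h1 := h0 B₀ hB₀ hf₀ subset_rfl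
    have h2 : rk n B₀ (A ∪ C) ≤ rk n B₀ (A' ∪ C) := rk_le_rk_of_subset_aclEq (hfin _ hf₀)
      ((union_subset_union_left _ hA').trans (subset_aclEq _))
    exact (h2.trans_lt h1).ne (hind B₀ hB₀ hf₀)

end Rank

/-! ### Omitting types through a generic sequence in an ultrapower -/

section OmittingTypes

open FirstOrder.Language Set Filter

variable {L : FirstOrder.Language.{u, v}} {M : Type w} [L.Structure M]

theorem realize_congr_of_eqOn {α : Type*} [DecidableEq α] (φ : L.Formula α) {v v' : α → M}
    (h : ∀ i ∈ φ.freeVarFinset, v i = v' i) : φ.Realize v ↔ φ.Realize v' :=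
  (BoundedFormula.realize_restrictFreeVar (φ := φ) (f := fun i => (i : α)) (v := v) v'
    (fun i => h i i.2)).symm.trans
    (BoundedFormula.realize_restrictFreeVar (φ := φ) (f := fun i => (i : α)) (v := v) v
      (fun _ => rfl)) |>.symm

/-- The projection of a definable set of sequences to finitely many coordinates is definable. -/
theorem definable_image_comp_formula [Nonempty M] (φ : L.Formula ℕ) {m : ℕ} (g : Fin m → ℕ) :
    (∅ : Set M).Definable L ((fun b : ℕ → M => b ∘ g) '' {b | φ.Realize b}) := by
  classical
  let F : Finset ℕ := φ.freeVarFinset ∪ Finset.univ.image g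
  let φ' : L.Formula F := φ.restrictFreeVar (fun i => ⟨i, Finset.mem_union_left _ i.2⟩)
  let g' : Fin m → F := fun i =>
    ⟨g i, Finset.mem_union_right _ (Finset.mem_image_of_mem _ (Finset.mem_univ _))⟩
  have h := (Set.empty_definable_iff.2 ⟨φ', rfl⟩ :
    (∅ : Set M).Definable L {z : F → M | φ'.Realize z}).image_comp g'
  have key : ∀ (z : F → M) (b : ℕ → M), (∀ i : F, b i = z i) → (φ'.Realize z ↔ φ.Realize b) :=
    fun z b h => BoundedFormula.realize_restrictFreeVar b (fun i => (h _).symm)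
  convert h using 1
  ext y
  constructor
  · rintro ⟨b, hb, rfl⟩
    exact ⟨fun i => b i, (key _ b fun _ => rfl).2 hb, rfl⟩
  · rintro ⟨z, hz, rfl⟩
    let b : ℕ → M := fun i => if h : i ∈ F then z ⟨i, h⟩ else Classical.arbitrary M
    have hb : ∀ i : F, b i = z i := fun i => by simp [b]
    refine ⟨b, (key z b hb).1 hz, ?_⟩
    funext i
    exact hb (g' i)

/-- The Henkin step: a variable not occurring in `φ` or `θ` is free to name a witness. -/
theorem exists_formula_witness (φ : L.Formula ℕ) (hφ : ∃ b : ℕ → M, φ.Realize b)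
    (θ : L.Formula (ℕ ⊕ Fin 1)) :
    ∃ φ' : L.Formula ℕ, (∃ b : ℕ → M, φ'.Realize b) ∧
      (∀ b : ℕ → M, φ'.Realize b → φ.Realize b) ∧
      ((∀ b : ℕ → M, φ'.Realize b → ∀ y, ¬ θ.Realize (Sum.elim b y)) ∨
        ∃ j, ∀ b : ℕ → M, φ'.Realize b → θ.Realize (Sum.elim b fun _ => b j)) := by
  classical
  by_cases hθ : ∀ b : ℕ → M, φ.Realize b → ∀ y, ¬ θ.Realize (Sum.elim b y)
  · exact ⟨φ, hφ, fun _ => id, Or.inl hθ⟩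
  push Not at hθ
  obtain ⟨b, hb, y, hy⟩ := hθ
  obtain ⟨j, hj⟩ := Infinite.exists_notMem_finset (φ.freeVarFinset ∪ θ.freeVarFinset.toLeft)
  rw [Finset.mem_union, not_or, Finset.mem_toLeft] at hj
  have key : ∀ b : ℕ → M, (φ ⊓ θ.relabel (Sum.elim id fun _ => j)).Realize b ↔
      φ.Realize b ∧ θ.Realize (Sum.elim b fun _ => b j) := by
    intro b
    rw [Formula.realize_inf, Formula.realize_relabel, Sum.comp_elim]
    rfl
  refine ⟨_, ⟨Function.update b j (y 0), (key _).2 ⟨?_, ?_⟩⟩, fun b hb => ((key b).1 hb).1,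
    Or.inr ⟨j, fun b hb => ((key b).1 hb).2⟩⟩
  · refine (realize_congr_of_eqOn φ fun i hi => ?_).1 hb
    rw [Function.update_of_ne (by rintro rfl; exact hj.1 hi)]
  · refine (realize_congr_of_eqOn θ fun i hi => ?_).1 hy
    rcases i with i | i
    · rw [Sum.elim_inl, Sum.elim_inl,
        Function.update_of_ne (by rintro rfl; exact hj.2 hi)]
    · simp [Subsingleton.elim i 0]

/-- The formula `φ` confines the coordinates selected by `g` to a nonempty ∅-definable set; as no
such set isolates `p`, some formula of `p` can be denied there. -/
theorem exists_formula_omit [Nonempty M] {m : ℕ} {p : Set (L.Formula (Fin m))}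
    (hp : ∀ D : Set (Fin m → M), (∅ : Set M).Definable L D → D.Nonempty →
      ∃ ψ ∈ p, ∃ y ∈ D, ¬ ψ.Realize y)
    (φ : L.Formula ℕ) (hφ : ∃ b : ℕ → M, φ.Realize b) (g : Fin m → ℕ) :
    ∃ φ' : L.Formula ℕ, (∃ b : ℕ → M, φ'.Realize b) ∧
      (∀ b : ℕ → M, φ'.Realize b → φ.Realize b) ∧
      ∃ ψ ∈ p, ∀ b : ℕ → M, φ'.Realize b → ¬ ψ.Realize (b ∘ g) := by
  obtain ⟨b, hb⟩ := hφ
  obtain ⟨ψ, hψ, _, ⟨b', hb', rfl⟩, hn⟩ :=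
    hp _ (definable_image_comp_formula φ g) ⟨_, b, hb, rfl⟩
  have key : ∀ b : ℕ → M, (φ ⊓ (ψ.relabel g).not).Realize b ↔
      φ.Realize b ∧ ¬ ψ.Realize (b ∘ g) := by
    intro b
    rw [Formula.realize_inf, Formula.realize_not, Formula.realize_relabel]
  exact ⟨_, ⟨b', (key _).2 ⟨hb', hn⟩⟩, fun b hb => ((key b).1 hb).1, ψ, hψ,
    fun b hb => ((key b).1 hb).2⟩

theorem countable_formula [Countable L.Symbols] {α : Type*} [Countable α] :
    Countable (L.Formula α) := by
  have h : #(Σ k, L.BoundedFormula α k) ≤ ℵ₀ := by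
    refine BoundedFormula.card_le.trans (max_le le_rfl ?_)
    refine add_le_aleph0.2 ⟨?_, ?_⟩
    · rw [lift_le_aleph0]; exact mk_le_aleph0
    · rw [lift_le_aleph0]; exact mk_le_aleph0
  have := mk_le_aleph0_iff.1 h
  exact Function.Injective.countable (f := fun φ : L.Formula α =>
    (⟨0, φ⟩ : Σ k, L.BoundedFormula α k)) (fun φ ψ h => by simpa using h)

/-- Countably many dense requirements are met along a decreasing sequence of formulas. -/
theorem exists_generic_sequence [Nonempty M] {ι : Type*} [Countable ι] [Nonempty ι]
    (R : ι → L.Formula ℕ → Prop)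
    (hR : ∀ i, ∀ φ : L.Formula ℕ, (∃ b : ℕ → M, φ.Realize b) → ∃ φ' : L.Formula ℕ,
      (∃ b : ℕ → M, φ'.Realize b) ∧ (∀ b : ℕ → M, φ'.Realize b → φ.Realize b) ∧ R i φ') :
    ∃ φ : ℕ → L.Formula ℕ, (∀ k, ∃ b : ℕ → M, (φ k).Realize b) ∧
      (∀ k l, k ≤ l → ∀ b : ℕ → M, (φ l).Realize b → (φ k).Realize b) ∧ ∀ i, ∃ k, R i (φ k) := by
  obtain ⟨e, he⟩ := exists_surjective_nat ι
  choose! f hf1 hf2 hf3 using hR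
  let φ : ℕ → L.Formula ℕ := fun k => Nat.rec ⊤ (fun k ψ => f (e k) ψ) k
  have h0 : ∀ k, ∃ b : ℕ → M, (φ k).Realize b := by
    intro k
    induction k with
    | zero => exact ⟨fun _ => Classical.arbitrary M, by simp [φ]⟩
    | succ k ih => exact hf1 _ _ ih
  refine ⟨φ, h0, fun k l hkl => ?_, fun i => ?_⟩
  · induction l, hkl using Nat.le_induction with
    | base => exact fun _ => id
    | succ l _ ih => exact fun b hb => ih b (hf2 _ _ (h0 l) b hb)
  · obtain ⟨k, rfl⟩ := he i
    exact ⟨k + 1, hf3 _ _ (h0 k)⟩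

/-- Łoś's theorem for countable ultrapowers, with the ultrapower given by its quotient map. -/
theorem exists_ultrapower (L : FirstOrder.Language.{u, v}) (M : Type w) [L.Structure M]
    [Nonempty M] :
    ∃ (N : Type w) (_ : L.Structure N) (q : (ℕ → M) → N), Function.Surjective q ∧
      ∀ {β : Type} (φ : L.Formula β) (x : β → ℕ → M),
        φ.Realize (fun i => q (x i)) ↔ ∀ᶠ k in hyperfilter ℕ, φ.Realize fun i => x i k :=
  ⟨(hyperfilter ℕ : Filter ℕ).Product (fun _ => M), inferInstance, fun x => Quotient.mk'' x,
    Quotient.mk''_surjective, fun φ x => Ultraproduct.realize_formula_cast φ x⟩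

/-- The omitting types theorem, for the theory of a given structure. -/
theorem exists_countable_omitting [Nonempty M] [Countable L.Symbols] {m : ℕ}
    {p : Set (L.Formula (Fin m))}
    (hp : ∀ D : Set (Fin m → M), (∅ : Set M).Definable L D → D.Nonempty →
      ∃ ψ ∈ p, ∃ y ∈ D, ¬ ψ.Realize y) :
    ∃ (N : Type w) (_ : L.Structure N), Countable N ∧ L.ElementarilyEquivalent N M ∧
      ∀ y : Fin m → N, ∃ ψ ∈ p, ¬ ψ.Realize y := by
  have := countable_formula (L := L) (α := ℕ ⊕ Fin 1)
  obtain ⟨φ, h0, hanti, hgen⟩ := exists_generic_sequence (M := M)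
    (ι := L.Formula (ℕ ⊕ Fin 1) ⊕ (Fin m → ℕ))
    (Sum.elim
      (fun θ φ => (∀ b : ℕ → M, φ.Realize b → ∀ y, ¬ θ.Realize (Sum.elim b y)) ∨
        ∃ j, ∀ b : ℕ → M, φ.Realize b → θ.Realize (Sum.elim b fun _ => b j))
      (fun g φ => ∃ ψ ∈ p, ∀ b : ℕ → M, φ.Realize b → ¬ ψ.Realize (b ∘ g)))
    (by
      rintro (θ | g) φ hφ
      · exact exists_formula_witness φ hφ θ
      · exact exists_formula_omit hp φ hφ g)
  choose b hb using h0
  have hU : ∀ (P : ℕ → Prop) (k : ℕ), (∀ l, k ≤ l → P l) → ∀ᶠ l in hyperfilter ℕ, P l :=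
    fun P k h => Nat.hyperfilter_le_atTop (eventually_atTop.2 ⟨k, h⟩)
  obtain ⟨N₀, _, q, hq, los⟩ := exists_ultrapower L M
  -- The class of the i-th coordinates of the realizations: whatever some formula of the sequence
  -- forces holds of `c`, because tails belong to the ultrafilter.
  let c : ℕ → N₀ := fun i => q fun k => b k i
  -- The Tarski–Vaught criterion, from the witness requirements.
  have hc : L.MeetsDefinable (range c) := by
    rintro D ⟨d, hd⟩ hD
    obtain ⟨θ, hθ⟩ := Set.definable_iff_exists_formula_sum.1 hD
    choose idx hidx using fun a : range c => a.2
    have hmem : ∀ x, x ∈ D ↔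
        (θ.relabel (Sum.map idx id)).Realize (Sum.elim c fun _ : Fin 1 => x) := by
      intro x
      have h1 : x ∈ D ↔ (fun _ : Fin 1 => x) ∈ {x : Fin 1 → N₀ | x 0 ∈ D} := Iff.rfl
      rw [h1, hθ, Formula.realize_relabel, mem_ofPred_eq, Sum.elim_comp_map]
      have h2 : c ∘ idx = fun a : range c => (a : N₀) := funext hidx
      rw [h2]
      rfl
    obtain ⟨d, rfl⟩ := hq d
    have key : ∀ x : ℕ → M, q x ∈ D ↔ ∀ᶠ l in hyperfilter ℕ,
        (θ.relabel (Sum.map idx id)).Realize (Sum.elim (b l) fun _ : Fin 1 => x l) := by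
      intro x
      rw [hmem]
      have := los (θ.relabel (Sum.map idx id)) (Sum.elim (fun i k => b k i) fun _ => x)
      convert this using 2
      · funext i; rcases i with i | i <;> rfl
      · funext l
        congr 1
        funext i; rcases i with i | i <;> rfl
    obtain ⟨k, hk⟩ := hgen (Sum.inl (θ.relabel (Sum.map idx id)))
    rcases hk with hk | ⟨j, hj⟩
    · obtain ⟨l, h1, h2⟩ := (((key d).1 hd).and
        (hU (fun l => k ≤ l) k fun _ => id)).exists
      exact absurd h1 (hk _ (hanti _ _ h2 _ (hb l)) _)
    · exact ⟨c j, (key _).2 (hU _ k fun l hl => hj _ (hanti _ _ hl _ (hb l))), j, rfl⟩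
  let S := hc.toElementarySubstructure
  have hS : (S : Set N₀) = range c := hc.closure_eq_self
  refine ⟨S, inferInstance, ?_, S.elementarilyEquivalent.trans ?_, fun y => ?_⟩
  · have : (S : Set N₀).Countable := hS ▸ countable_range c
    exact this.to_subtype
  · refine elementarilyEquivalent_iff.2 fun φ => ?_
    have := los φ (Empty.elim)
    rw [Subsingleton.elim (fun i : Empty => q (i.elim)) default] at this
    refine this.trans ?_
    have h2 : ∀ k : ℕ, (fun i : Empty => (Empty.elim i : ℕ → M) k) = default :=
      fun k => Subsingleton.elim _ _
    simp only [h2, eventually_const]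
    rfl
  · have hy : ∀ i, ∃ j, c j = y i := fun i => by
      have : (y i : N₀) ∈ (S : Set N₀) := (y i).2
      rwa [hS] at this
    choose g hg using hy
    obtain ⟨k, ψ, hψ, hk⟩ := hgen (Sum.inr g)
    refine ⟨ψ, hψ, fun hr => ?_⟩
    rw [← S.subtype.map_formula] at hr
    have h1 : S.subtype ∘ y = fun i => c (g i) := funext fun i => (hg i).symm
    rw [h1, los] at hr
    obtain ⟨l, h1, h2⟩ := (hr.and (hU (fun l => k ≤ l) k fun _ => id)).exists
    exact hk _ (hanti _ _ h2 _ (hb l)) h1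

end OmittingTypes

/-! ### Finitely many definable sets, from categoricity -/

section RyllNardzewski

open FirstOrder.Language Set

variable {L : FirstOrder.Language.{u, v}} {M : Type w} [L.Structure M]

/-- In a saturated structure with infinitely many `∅`-definable sets of `m`-tuples, some tuple lies
only in definable sets with infinitely many definable subsets. -/
theorem exists_forall_infinite_definable_subsets {κ : Cardinal.{w}} (hκ : ℵ₀ ≤ κ)
    (hsat : IsSaturated L M κ) {m : ℕ}
    (hinf : ¬ {D : Set (Fin m → M) | (∅ : Set M).Definable L D}.Finite) :
    ∃ x : Fin m → M, ∀ D : Set (Fin m → M), (∅ : Set M).Definable L D → x ∈ D →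
      ¬ {E : Set (Fin m → M) | (∅ : Set M).Definable L E ∧ E ⊆ D}.Finite := by
  -- Small definable sets form an ideal that omits the whole space, so the complements are finitely
  -- satisfiable and saturation realizes all of them at once.
  let Small : Set (Fin m → M) → Prop := fun D =>
    {E : Set (Fin m → M) | (∅ : Set M).Definable L E ∧ E ⊆ D}.Finite
  obtain ⟨x, hx⟩ := hsat ∅ (by simpa using aleph0_pos.trans_le hκ) m
    {φ | Small {y | φ.Realize y}ᶜ} (by
      intro p₀ hp₀ hf
      by_contra! hcon
      have hsmall : Small (⋃ φ ∈ p₀, {y : Fin m → M | φ.Realize y}ᶜ) := by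
        clear hcon
        induction p₀, hf using Set.Finite.induction_on with
        | empty =>
          refine (finite_singleton ∅).subset ?_
          rintro E ⟨-, hE⟩
          simpa using hE
        | @insert φ p₁ _ _ ih =>
          rw [biUnion_insert]
          have h1 : Small {y | φ.Realize y}ᶜ := hp₀ (mem_insert _ _)
          have h2 := ih ((subset_insert _ _).trans hp₀)
          refine (h1.image2 (· ∪ ·) h2).subset ?_
          rintro E ⟨hE, hsub⟩
          have hφ : (∅ : Set M).Definable L {y : Fin m → M | φ.Realize y}ᶜ :=
            Set.Definable.compl ⟨φ, rfl⟩
          refine ⟨E ∩ {y | φ.Realize y}ᶜ, ⟨hE.inter hφ, inter_subset_right⟩,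
            E \ {y | φ.Realize y}ᶜ, ⟨hE.sdiff hφ, fun z hz => (hsub hz.1).resolve_left hz.2⟩, ?_⟩
          exact inter_union_sdiff E _
      have huniv : (⋃ φ ∈ p₀, {y : Fin m → M | φ.Realize y}ᶜ) = Set.univ := by
        refine eq_univ_of_forall fun y => ?_
        obtain ⟨φ, hφ, hn⟩ := hcon y
        exact mem_biUnion hφ hn
      rw [huniv] at hsmall
      exact hinf (hsmall.subset fun D hD => ⟨hD, subset_univ _⟩))
  refine ⟨x, ?_⟩
  rintro D ⟨φ, rfl⟩ hxD hD
  have : φ.not ∈ {φ : L[[(∅ : Set M)]].Formula (Fin m) | Small {y | φ.Realize y}ᶜ} := by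
    have he : {y : Fin m → M | φ.not.Realize y}ᶜ = {y | φ.Realize y} := by
      ext y; simp
    rw [mem_ofPred_eq, he]
    exact hD
  exact Formula.realize_not.1 (hx _ this) hxD

/-- The part of the Ryll-Nardzewski theorem that is needed: saturated models of an `ℵ₀`-categorical
theory have only finitely many `∅`-definable sets of `m`-tuples. -/
theorem finite_definable_fin [Countable L.Symbols] {T : L.Theory}
    (hcat : Cardinal.Categorical (ℵ₀ : Cardinal.{w}) T) [Nonempty M] [M ⊨ T] {κ : Cardinal.{w}}
    (hκ : ℵ₀ ≤ κ) (hsat : IsSaturated L M κ) (m : ℕ) :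
    {D : Set (Fin m → M) | (∅ : Set M).Definable L D}.Finite := by
  by_contra hinf
  have hM : Infinite M := by
    by_contra h
    rw [not_infinite_iff_finite] at h
    exact hinf (Set.toFinite _)
  obtain ⟨x, hx⟩ := exists_forall_infinite_definable_subsets hκ hsat hinf
  -- The type of `x` is not isolated: an isolating set would contain `x` and have no definable
  -- subsets besides ∅ and itself.
  obtain ⟨N, _, hN, hNM, homit⟩ := exists_countable_omitting
    (p := {ψ : L.Formula (Fin m) | ψ.Realize x}) (by
      rintro D hD ⟨d, hd⟩
      by_contra! hcon
      have hmem : ∀ E : Set (Fin m → M), (∅ : Set M).Definable L E → x ∈ E → D ⊆ E := by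
        intro E hE hxE
        obtain ⟨ψ, rfl⟩ := Set.empty_definable_iff.1 hE
        exact hcon ψ hxE
      have hxD : x ∈ D := by
        by_contra hxD
        exact hmem _ hD.compl hxD hd hd
      refine hx D hD hxD ((Set.toFinite {∅, D}).subset ?_)
      rintro E ⟨hE, hED⟩
      by_cases hxE : x ∈ E
      · exact Or.inr (hED.antisymm (hmem E hE hxE))
      · refine Or.inl (eq_empty_of_forall_notMem fun y hy => ?_)
        exact hmem _ hE.compl hxE (hED hy) hy)
  have hNinf : Infinite N := hNM.infinite_iff.2 hM
  have hNT : N ⊨ T := hNM.theory_model_iff.2 inferInstance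
  have hcard : L.card ≤ ℵ₀ := mk_le_aleph0
  obtain ⟨S, hxS, hS⟩ := exists_elementarySubstructure_card_eq L (range x) (ℵ₀ : Cardinal.{w})
    le_rfl (by simp)
    (by simpa using hcard) (by simp)
  have hST : S ⊨ T := (S.theory_model_iff T).2 inferInstance
  have hS' : #S = ℵ₀ := by simpa using hS
  have : Nonempty S := by
    rw [← mk_ne_zero_iff, hS']
    exact aleph0_ne_zero
  -- A countable model realizing the type of `x` is isomorphic to one omitting it, a contradiction.
  obtain ⟨e⟩ := hcat (Theory.ModelType.of T S) (Theory.ModelType.of T N) hS' (mk_eq_aleph0 N)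
  let x' : Fin m → S := fun i => ⟨x i, hxS (mem_range_self i)⟩
  let e' : S ≃[L] N := e
  obtain ⟨ψ, hψ, hn⟩ := homit (e' ∘ x')
  rw [StrongHomClass.realize_formula] at hn
  rw [← S.subtype.map_formula] at hn
  exact hn hψ

end RyllNardzewski

/-! ### Back-and-forth for M^eq and finiteness of algebraic closures -/

section BackAndForth

open FirstOrder.Language Set

variable {L : FirstOrder.Language.{u, v}} {M : Type w} [L.Structure M]

/-- The structure has only finitely many `∅`-definable sets of `m`-tuples, for every `m`. -/
def FinitelyManyDefinable (L : FirstOrder.Language.{u, v}) (M : Type w) [L.Structure M] : Prop :=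
  ∀ m : ℕ, {D : Set (Fin m → M) | (∅ : Set M).Definable L D}.Finite

theorem FinitelyManyDefinable.finite (h : FinitelyManyDefinable L M) (α : Type) [Finite α] :
    {D : Set (α → M) | (∅ : Set M).Definable L D}.Finite := by
  obtain ⟨m, ⟨e⟩⟩ := Finite.exists_equiv_fin α
  refine Set.Finite.of_finite_image (f := fun D => (fun g : Fin m → M => g ∘ e) ⁻¹' D)
    ((h m).subset ?_) ?_
  · rintro _ ⟨D, hD, rfl⟩
    exact hD.preimage_comp e
  · intro D _ D' _ hDD
    exact preimage_injective.2 (fun y => ⟨y ∘ e.symm, by funext i; simp⟩) hDD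

/-- Two tuples of real elements have the same type over `∅`. -/
def SameType (L : FirstOrder.Language.{u, v}) {M : Type w} [L.Structure M] {α : Type}
    (Y Y' : α → M) : Prop :=
  ∀ D : Set (α → M), (∅ : Set M).Definable L D → Y ∈ D → Y' ∈ D

theorem SameType.symm {α : Type} {Y Y' : α → M} (h : SameType L Y Y') : SameType L Y' Y := by
  intro D hD hY'
  by_contra hY
  exact h _ hD.compl hY hY'

/-- The type of the long tuple is cut out by a finite intersection of definable sets, hence by one
definable set; its projection contains `Y`, so also `Y'`. -/
theorem SameType.exists_extension (hfin : FinitelyManyDefinable L M) {α β : Type} [Finite α]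
    [Finite β] {Y Y' : α → M} (h : SameType L Y Y') (Z : β → M) :
    ∃ Z' : β → M, SameType L (Sum.elim Y Z) (Sum.elim Y' Z') := by
  let s : Set (Set (α ⊕ β → M)) := {D | (∅ : Set M).Definable L D ∧ Sum.elim Y Z ∈ D}
  have hs : s.Finite := (hfin.finite (α ⊕ β)).subset fun D hD => hD.1
  have : Finite s := hs
  have hdef : (∅ : Set M).Definable L (⋂ D : s, D.1) :=
    Set.definable_iInter_of_finite fun D => D.2.1
  obtain ⟨Z', hZ'⟩ := h _ hdef.exists_of_finite ⟨Z, mem_iInter.2 fun D => D.2.2⟩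
  exact ⟨Z', fun D hD hY => mem_iInter.1 hZ' ⟨D, hD, hY⟩⟩

/-- Corresponding elements of `M^eq` built from the entries of two tuples of real elements. -/
inductive Corr {α : Type} (Y Y' : α → M) : Meq L M → Meq L M → Prop
  | real (i : α) : Corr Y Y' (.real (Y i)) (.real (Y' i))
  | imag {k : ℕ} (E : DefEquiv L M (k + 1)) (f : Fin (k + 1) → α) :
      Corr Y Y' (.imag k E (Quotient.mk E.1 (Y ∘ f))) (.imag k E (Quotient.mk E.1 (Y' ∘ f)))

theorem Corr.symm {α : Type} {Y Y' : α → M} {a a' : Meq L M} (h : Corr Y Y' a a') :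
    Corr Y' Y a' a := by
  cases h with
  | real i => exact .real i
  | imag E f => exact .imag E f

theorem Corr.inl {α β : Type} {Y Y' : α → M} {a a' : Meq L M} (h : Corr Y Y' a a')
    (Z Z' : β → M) : Corr (Sum.elim Y Z) (Sum.elim Y' Z') a a' := by
  cases h with
  | real i => exact .real (Y := Sum.elim Y Z) (Y' := Sum.elim Y' Z') (Sum.inl i)
  | imag E f => exact .imag (Y := Sum.elim Y Z) (Y' := Sum.elim Y' Z') E (Sum.inl ∘ f)

theorem Corr.inr {α β : Type} {Z Z' : β → M} {a a' : Meq L M} (h : Corr Z Z' a a')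
    (Y Y' : α → M) : Corr (Sum.elim Y Z) (Sum.elim Y' Z') a a' := by
  cases h with
  | real i => exact .real (Y := Sum.elim Y Z) (Y' := Sum.elim Y' Z') (Sum.inr i)
  | imag E f => exact .imag (Y := Sum.elim Y Z) (Y' := Sum.elim Y' Z') E (Sum.inr ∘ f)

/-- Every element of `M^eq` comes from a finite real tuple, uniformly in the tuple. -/
theorem exists_corr (a : Meq L M) :
    ∃ (k : ℕ) (Z : Fin k → M), ∀ Z' : Fin k → M, ∃ a', Corr Z Z' a a' := by
  cases a with
  | real x => exact ⟨1, fun _ => x, fun Z' => ⟨_, .real 0⟩⟩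
  | imag k E q =>
    induction q using Quotient.inductionOn with | _ z
    exact ⟨k + 1, z, fun Z' => ⟨_, .imag E id⟩⟩

theorem Corr.exists_real {α : Type} {Y Y' : α → M} {y : M} {a' : Meq L M}
    (h : Corr Y Y' (.real y) a') : ∃ i, y = Y i ∧ a' = .real (Y' i) := by
  cases h with
  | real i => exact ⟨i, rfl, rfl⟩

theorem SameType.rel_iff {α : Type} {Y Y' : α → M} (h : SameType L Y Y') {k : ℕ}
    {E : DefEquiv L M k} {f g : Fin k → α} (hE : E.1 (Y ∘ f) (Y ∘ g)) :
    E.1 (Y' ∘ f) (Y' ∘ g) :=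
  h _ (E.2.preimage_comp (Sum.elim f g)) hE

/-- Coincidences between real entries or between classes are ∅-definable conditions on the coding
tuple, so the correspondence is single-valued. -/
theorem Corr.eq {α : Type} {Y Y' : α → M} (hY : SameType L Y Y') {a a' b b' : Meq L M}
    (ha : Corr Y Y' a a') (hb : Corr Y Y' b b') (h : a = b) : a' = b' := by
  subst h
  cases ha with
  | real i =>
    obtain ⟨j, hj, rfl⟩ := hb.exists_real
    have : Y' i = Y' j := hY {v | v i = v j}
      (Set.empty_definable_iff.2 ⟨(Term.var i).equal (Term.var j), by ext; simp⟩) hj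
    rw [this]
  | imag E f =>
    generalize hq : Quotient.mk E.1 (Y ∘ f) = q at hb
    cases hb with
    | imag _ g =>
      congr 1
      exact Quotient.sound (hY.rel_iff (Quotient.exact hq))

theorem Corr.relMap {α : Type} {Y Y' : α → M} (hY : SameType L Y Y') {m : ℕ}
    (R : (eqLang L M).Relations m) {x x' : Fin m → Meq L M} (hx : ∀ i, Corr Y Y' (x i) (x' i))
    (h : Structure.RelMap R x) : Structure.RelMap R x' := by
  cases R with
  | rel R =>
    obtain ⟨y, hy, hR⟩ := h
    choose j hj hj' using fun i => (hy i ▸ hx i).exists_real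
    obtain rfl : y = Y ∘ j := funext hj
    exact ⟨Y' ∘ j, hj', hY {v | Structure.RelMap R (v ∘ j)} (Set.empty_definable_iff.2
      ⟨R.formula fun i => Term.var (j i), by ext; simp [Formula.realize_rel]; rfl⟩) hR⟩
  | graph f =>
    obtain ⟨y, hy, hf⟩ := h
    choose j hj hj' using fun i => (hy i ▸ hx (Fin.castSucc i)).exists_real
    obtain ⟨l, hl, hl'⟩ := (hf ▸ hx (Fin.last _)).exists_real
    obtain rfl : y = Y ∘ j := funext hj
    refine ⟨Y' ∘ j, hj', hl'.trans ?_⟩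
    have : Structure.funMap f (Y' ∘ j) = Y' l := hY {v | Structure.funMap f (v ∘ j) = v l}
      (Set.empty_definable_iff.2 ⟨(Term.func f fun i => Term.var (j i)).equal (Term.var l),
        by ext; simp; rfl⟩) hl
    rw [this]
  | home =>
    obtain ⟨y, hy⟩ := h
    obtain ⟨j, -, hj⟩ := (hy ▸ hx 0).exists_real
    exact ⟨_, hj⟩
  | sort E =>
    obtain ⟨q, hq⟩ := h
    have h0 := hx 0
    rw [hq] at h0
    generalize hx' : x' 0 = c at h0
    cases h0 with
    | imag _ g => exact ⟨_, hx'⟩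
  | proj E =>
    obtain ⟨y, hy, hq⟩ := h
    choose j hj hj' using fun i => (hy i ▸ hx (Fin.castSucc i)).exists_real
    obtain rfl : y = Y ∘ j := funext hj
    exact ⟨Y' ∘ j, hj', (Corr.eq hY (.imag E j) (hx (Fin.last _)) hq.symm).symm⟩

theorem Corr.term_realize {α β : Type*} {γ : Type} {Y Y' : γ → M} (t : (eqLang L M).Term (α ⊕ β))
    {v v' : α → Meq L M} {xs xs' : β → Meq L M} (hv : ∀ i, Corr Y Y' (v i) (v' i))
    (hxs : ∀ i, Corr Y Y' (xs i) (xs' i)) :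
    Corr Y Y' (t.realize (Sum.elim v xs)) (t.realize (Sum.elim v' xs')) := by
  cases t with
  | var i => rcases i with i | i <;> simp [hv, hxs]
  | func f => exact Empty.elim f

/-- Formulas of `M^eq` do not distinguish corresponding elements built from real tuples of the same
type. -/
theorem SameType.realize_iff (hfin : FinitelyManyDefinable L M) {β : Type*} {m : ℕ}
    (φ : (eqLang L M).BoundedFormula β m) {α : Type} [Finite α] {Y Y' : α → M}
    (hY : SameType L Y Y') {v v' : β → Meq L M} {xs xs' : Fin m → Meq L M}
    (hv : ∀ i, Corr Y Y' (v i) (v' i)) (hxs : ∀ i, Corr Y Y' (xs i) (xs' i)) :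
    φ.Realize v xs ↔ φ.Realize v' xs' := by
  induction φ generalizing α v v' with
  | falsum => rfl
  | equal t₁ t₂ =>
    have h1 := Corr.term_realize t₁ hv hxs
    have h2 := Corr.term_realize t₂ hv hxs
    exact ⟨h1.eq hY h2, h1.symm.eq hY.symm h2.symm⟩
  | rel R ts =>
    have h := fun i => Corr.term_realize (ts i) hv hxs
    exact ⟨Corr.relMap hY R h, Corr.relMap hY.symm R fun i => (h i).symm⟩
  | imp _ _ ih₁ ih₂ =>
    rw [BoundedFormula.realize_imp, BoundedFormula.realize_imp, ih₁ hY hv hxs, ih₂ hY hv hxs]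
  | all φ ih =>
    have key : ∀ {Y Y' : α → M}, SameType L Y Y' → ∀ {v v' : β → Meq L M},
        (∀ i, Corr Y Y' (v i) (v' i)) → ∀ {xs xs' : Fin _ → Meq L M},
        (∀ i, Corr Y Y' (xs i) (xs' i)) → φ.all.Realize v xs → φ.all.Realize v' xs' := by
      intro Y Y' hY v v' hv xs xs' hxs h
      rw [BoundedFormula.realize_all] at h ⊢
      intro a'
      -- The quantified element is coded by reals; extending the other tuple by matching reals gives
      -- its counterpart.
      obtain ⟨k, Z', hZ'⟩ := exists_corr a'
      obtain ⟨Z, hZ⟩ := hY.symm.exists_extension hfin Z'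
      obtain ⟨a, ha⟩ := hZ' Z
      refine (ih hZ.symm (fun i => (hv i).inl Z Z') fun i => ?_).1 (h a)
      refine Fin.lastCases ?_ (fun i => ?_) i
      · simpa using ha.symm.inr Y Y'
      · simpa using (hxs i).inl Z Z'
    exact ⟨key hY hv hxs, key hY.symm (fun i => (hv i).symm) fun i => (hxs i).symm⟩

theorem SameType.mem_of_definable (hfin : FinitelyManyDefinable L M) {α : Type} [Finite α]
    {Y Y' : α → M} (hY : SameType L Y Y') {A S : Set (Meq L M)}
    (hA : ∀ a ∈ A, Corr Y Y' a a) (hS : A.Definable₁ (eqLang L M) S) {a a' : Meq L M}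
    (ha : Corr Y Y' a a') (h : a ∈ S) : a' ∈ S := by
  obtain ⟨φ, hφ⟩ := Set.definable_iff_exists_formula_sum.1 hS
  have hmem : ∀ x, x ∈ S ↔ φ.Realize (Sum.elim (fun b : A => (b : Meq L M)) fun _ : Fin 1 => x) :=
    fun x => Set.ext_iff.1 hφ fun _ => x
  rw [hmem] at h ⊢
  refine (hY.realize_iff hfin φ ?_ (fun i => i.elim0)).1 h
  rintro (b | _)
  · exact hA b b.2
  · exact ha

theorem exists_corr_of_finite {A : Set (Meq L M)} (hA : A.Finite) :
    ∃ (α : Type) (_ : Finite α) (Y : α → M), ∀ a ∈ A, Corr Y Y a a := by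
  induction A, hA using Set.Finite.induction_on with
  | empty => exact ⟨Empty, inferInstance, Empty.elim, by simp⟩
  | @insert a A _ _ ih =>
    obtain ⟨α, _, Y, hY⟩ := ih
    obtain ⟨k, Z, hZ⟩ := exists_corr a
    obtain ⟨a', ha'⟩ := hZ Z
    have haa : Corr Z Z a a := by
      cases ha' with
      | real i => exact .real i
      | imag E f => exact .imag E f
    refine ⟨α ⊕ Fin k, inferInstance, Sum.elim Y Z, ?_⟩
    rintro b (rfl | hb)
    · exact haa.inr Y Y
    · exact (hY b hb).inl Z Z

/-- The algebraic elements of a single sort, parametrized by real tuples, are finite in number. -/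
theorem finite_aclEq_inter_range (hfin : FinitelyManyDefinable L M) {A : Set (Meq L M)}
    (hA : A.Finite) {β : Type} [Finite β] (g : (β → M) → Meq L M)
    (hg : ∀ Z Z', Corr Z Z' (g Z) (g Z')) : (aclEq A ∩ range g).Finite := by
  obtain ⟨α, _, Y, hY⟩ := exists_corr_of_finite hA
  -- The type of `Z` over the tuple `Y` coding `A`; it takes finitely many values.
  let τ : (β → M) → Set (Set (α ⊕ β → M)) := fun Z =>
    {D | (∅ : Set M).Definable L D ∧ Sum.elim Y Z ∈ D}
  have hτ : (range τ).Finite := by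
    refine (hfin.finite (α ⊕ β)).powerset.subset ?_
    rintro _ ⟨Z, rfl⟩ D hD
    exact hD.1
  have hsub : aclEq A ∩ range g ⊆ ⋃ t ∈ range τ, aclEq A ∩ g '' {Z | τ Z = t} := by
    rintro _ ⟨ha, Z, rfl⟩
    exact mem_biUnion (mem_range_self Z) ⟨ha, Z, rfl, rfl⟩
  refine (hτ.biUnion fun t _ => ?_).subset hsub
  -- A finite `A`-definable set containing one element of the class contains the whole class.
  rcases (aclEq A ∩ g '' {Z | τ Z = t}).eq_empty_or_nonempty with h | ⟨_, ⟨S, hS, hSf, ha⟩, Z, hZ, rfl⟩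
  · rw [h]; exact finite_empty
  · refine hSf.subset ?_
    rintro _ ⟨-, Z', hZ', rfl⟩
    have hsame : SameType L (Sum.elim Y Z) (Sum.elim Y Z') := by
      intro D hD hmem
      have h1 : D ∈ τ Z := ⟨hD, hmem⟩
      rw [show τ Z = τ Z' from hZ.trans hZ'.symm] at h1
      exact h1.2
    exact hsame.mem_of_definable hfin (fun a ha => (hY a ha).inl Z Z') hS ((hg Z Z').inr Y Y) ha

theorem finite_defEquiv (hfin : FinitelyManyDefinable L M) (k : ℕ) : Finite (DefEquiv L M k) := by
  have : Finite {D : Set (Fin k ⊕ Fin k → M) | (∅ : Set M).Definable L D} :=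
    hfin.finite (Fin k ⊕ Fin k)
  refine Finite.of_injective (β := {D : Set (Fin k ⊕ Fin k → M) | (∅ : Set M).Definable L D})
    (fun E => ⟨_, E.2⟩) fun E E' h => ?_
  refine Subtype.ext (Setoid.ext fun x y => ?_)
  exact Set.ext_iff.1 (Subtype.ext_iff.1 h) (Sum.elim x y)

theorem finite_aclN (hfin : FinitelyManyDefinable L M) (n : ℕ) {A : Set (Meq L M)}
    (hA : A.Finite) : (aclN n A).Finite := by
  unfold aclN
  induction n with
  | zero =>
    refine (finite_aclEq_inter_range hfin hA (β := Fin 1) (fun Z => .real (Z 0))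
      fun Z Z' => .real 0).subset (inter_subset_inter_right _ ?_)
    rintro _ ⟨x, rfl⟩
    exact ⟨fun _ => x, rfl⟩
  | succ n ih =>
    have := finite_defEquiv hfin (n + 1)
    refine (ih.union (Set.finite_iUnion fun E : DefEquiv L M (n + 1) =>
      finite_aclEq_inter_range hfin hA (fun Z : Fin (n + 1) → M => .imag n E (Quotient.mk E.1 Z))
        fun Z Z' => .imag E id)).subset ?_
    rintro a ⟨ha, ha' | ⟨E, q, rfl⟩⟩
    · exact Or.inl ⟨ha, ha'⟩
    · induction q using Quotient.inductionOn with | _ z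
      exact Or.inr (mem_iUnion.2 ⟨E, ha, z, rfl⟩)

end BackAndForth

end NRank

theorem mainTheorem2 {L : FirstOrder.Language.{u, v}} [Countable L.Symbols]
    (T : L.Theory) (hcomplete : T.IsComplete)
    (hcategorical : Cardinal.Categorical (ℵ₀ : Cardinal.{w}) T)
    (M : Type w) [L.Structure M] [Nonempty M] [M ⊨ T]
    (κ : Cardinal.{w}) (hκ : ℵ₀ ≤ κ) (hsat : NRank.IsSaturated L M κ)
    (n : ℕ) (hexchange : NRank.Exchange L M κ n) :
    (∀ A B C : Set (NRank.Meq L M), A.Finite → B.Finite → #C < κ → B ⊆ NRank.level L M n →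
      NRank.rk n A (B ∪ C) < NRank.rk n A C → NRank.rk n B (A ∪ C) < NRank.rk n B C) ∧
    (∀ A B C : Set (NRank.Meq L M), #A < κ → #B < κ → #C < κ → B ⊆ NRank.level L M n →
      ¬ NRank.Indep n A B C → ¬ NRank.Indep n B A C) := by
  have hfin : NRank.FinitelyManyDefinable L M :=
    NRank.finite_definable_fin hcategorical hκ hsat
  obtain ⟨h1, h2⟩ := NRank.rk_symmetry hκ hexchange
    (fun A hA => NRank.finite_aclN hfin n (A := A) hA)
  exact ⟨h1, fun A B C _ _ hC hB h => h2 A B C hC hB h⟩
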